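/- There are $n\ge 2$ agents and $m\ge n$ items; agent $i$ has utility $u_i(j)\ge 0$ for item $j$, and $u_i(j)\neq u_i(j')$ whenever $j\ne j'$. The round-robin allocation is obtained by letting the agents pick items one at a time in the order $1,2,\dots,n,1,2,\dots$, each time taking the remaining item of highest utility for the picking agent, until all $m$ items are allocated. In the noisy value query model with noise parameter $\rho$, an adaptive, possibly randomized algorithm queries pairs $(i,j)$. Independently for each query (including repeated ones, and independently of the algorithm's random seed), the answer is $u_i(j)$ with probability $1-\rho$, and with probability $\rho$ it is an arbitrary real number chosen by an adversary, who knows all the utilities, the past queries and answers, and the current query. An algorithm is called correct with probability at least $1-\delta$ if, for all utilities as above and for every adversary, it outputs the round-robin allocation with probability at least $1-\delta$. **Theorem.** Let $\rho\in(0,1/2)$ and $c>0$ be constants. There is a constant $C>0$, depending only on $\rho$ and $c$, such that for all $m\ge n\ge 2$, all $\delta\in(0,1/2-c)$ and every (possibly randomized) algorithm that is correct with probability at least $1-\delta$ in the noisy value query model, the following holds: for all utilities $(u_i(j))$ as above there is an adversary against which the expected number of queries made by the algorithm is at least $C\,nm\log(1/\delta)$. -/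

import Mathlib

open MeasureTheory ProbabilityTheory
open scoped ENNReal

namespace RoundRobin

/-! ### Utilities and the round-robin allocation -/

/-- `u i j` is the utility of agent `i` for item `j`: nonnegative, and with no ties within an
agent. Agents and items are numbered from `0`. -/
structure IsUtilityProfile {n m : ℕ} (u : Fin n → Fin m → ℝ) : Prop where
  nonneg : ∀ i j, 0 ≤ u i j
  injective : ∀ i, Function.Injective (u i)

/-- `j` is an item of highest utility in `S`, with respect to the utilities `v`. -/
def IsFavorite {m : ℕ} (v : Fin m → ℝ) (S : Finset (Fin m)) (j : Fin m) : Prop :=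
  j ∈ S ∧ ∀ k ∈ S, v k ≤ v j

open Classical in
/-- The items that remain after the first `t` turns. In turn `t` (counted from `0`) the agent
`t % n` takes her favorite remaining item. -/
noncomputable def remaining {n m : ℕ} (u : Fin n → Fin m → ℝ) : ℕ → Finset (Fin m)
  | 0 => Finset.univ
  | t + 1 => (remaining u t).filter
      (fun j => ¬ ∃ i : Fin n, (i : ℕ) = t % n ∧ IsFavorite (u i) (remaining u t) j)

/-- An allocation is given by the bundle of each agent. -/
abbrev Allocation (n m : ℕ) : Type := Fin n → Finset (Fin m)

open Classical in
/-- The round-robin allocation: agent `i` gets the items that she takes in her turns, among the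
`m` turns `0, …, m - 1`. -/
noncomputable def roundRobin {n m : ℕ} (u : Fin n → Fin m → ℝ) : Allocation n m :=
  fun i => Finset.univ.filter
    (fun j => ∃ t < m, (i : ℕ) = t % n ∧ IsFavorite (u i) (remaining u t) j)

/-! ### Noisy value queries -/

/-- A value query asks for the utility of an agent for an item. -/
abbrev Query (n m : ℕ) : Type := Fin n × Fin m

/-- The past queries and their answers, in chronological order. -/
abbrev History (n m : ℕ) : Type := List (Query n m × ℝ)

/-- The adversary chooses the value of a corrupted answer from the whole utility profile, the
past queries and answers, and the current query. -/
abbrev Adversary (n m : ℕ) : Type :=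
  (Fin n → Fin m → ℝ) → History n m → Query n m → ℝ

/-- An adaptive deterministic algorithm: after each history it either makes a further query or
stops and outputs an allocation. -/
abbrev DetAlgorithm (n m : ℕ) : Type := History n m → Query n m ⊕ Allocation n m

/-- A randomized algorithm: an adaptive algorithm with access to a random seed from an arbitrary
probability space. -/
structure RandAlgorithm (n m : ℕ) where
  Seed : Type*
  [measurableSpace : MeasurableSpace Seed]
  seedLaw : Measure Seed
  [isProbabilityMeasure : IsProbabilityMeasure seedLaw]
  strategy : Seed → DetAlgorithm n m
  measurableSet_strategy : ∀ (h : History n m) (a : Query n m ⊕ Allocation n m),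
    MeasurableSet {r | strategy r h = a}

attribute [instance] RandAlgorithm.measurableSpace RandAlgorithm.isProbabilityMeasure

/-- The answer to the query `q` after the history `h`: the adversary's value if the answer is
corrupted, the true utility otherwise. -/
def answer {n m : ℕ} (u : Fin n → Fin m → ℝ) (adv : Adversary n m) (h : History n m)
    (q : Query n m) (corrupted : Bool) : ℝ :=
  if corrupted then adv u h q else u q.1 q.2

/-- The history after `t` steps, where `b k` says whether the answer to the `k`-th query
(counted from `0`) is corrupted. The history no longer changes once the algorithm has stopped. -/
def historyAt {n m : ℕ} (s : DetAlgorithm n m) (u : Fin n → Fin m → ℝ) (adv : Adversary n m)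
    (b : ℕ → Bool) : ℕ → History n m
  | 0 => []
  | t + 1 =>
    match s (historyAt s u adv b t) with
    | Sum.inl q => historyAt s u adv b t ++
        [(q, answer u adv (historyAt s u adv b t) q (b t))]
    | Sum.inr _ => historyAt s u adv b t

/-- The run stops, with output `A`. -/
def Outputs {n m : ℕ} (s : DetAlgorithm n m) (u : Fin n → Fin m → ℝ) (adv : Adversary n m)
    (b : ℕ → Bool) (A : Allocation n m) : Prop :=
  ∃ t, s (historyAt s u adv b t) = Sum.inr A

/-- The total number of queries made in the run (`∞` if it does not stop). -/
noncomputable def numQueries {n m : ℕ} (s : DetAlgorithm n m) (u : Fin n → Fin m → ℝ)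
    (adv : Adversary n m) (b : ℕ → Bool) : ℝ≥0∞ :=
  ⨆ t, ((historyAt s u adv b t).length : ℝ≥0∞)

/-- The law of the noise: each answer is corrupted with probability `ρ`, independently. -/
noncomputable def noiseLaw (ρ : unitInterval) : Measure (ℕ → Bool) :=
  Measure.infinitePi (fun _ => bernoulliMeasure true false ρ)

namespace RandAlgorithm

/-- The joint law of the seed and the noise, which are independent. -/
noncomputable def law {n m : ℕ} (alg : RandAlgorithm n m) (ρ : unitInterval) :
    Measure (alg.Seed × (ℕ → Bool)) :=
  alg.seedLaw.prod (noiseLaw ρ)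

/-- Whatever the utilities and the adversary, the algorithm outputs the round-robin allocation
with probability at least `1 - δ`. -/
def IsCorrect {n m : ℕ} (alg : RandAlgorithm n m) (ρ : unitInterval) (δ : ℝ) : Prop :=
  ∀ (adv : Adversary n m) (u : Fin n → Fin m → ℝ), IsUtilityProfile u →
    ENNReal.ofReal (1 - δ) ≤
      alg.law ρ {x | Outputs (alg.strategy x.1) u adv x.2 (roundRobin u)}

/-- The expected number of queries on the utilities `u`, against the adversary `adv`. -/
noncomputable def expectedQueries {n m : ℕ} (alg : RandAlgorithm n m) (ρ : unitInterval)
    (u : Fin n → Fin m → ℝ) (adv : Adversary n m) : ℝ≥0∞ :=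
  ∫⁻ x, numQueries (alg.strategy x.1) u adv x.2 ∂(alg.law ρ)

end RandAlgorithm

end RoundRobin

namespace RoundRobin

/-! ### Binary-noise chains -/

/-! Fix `u` and take `V` above all utilities. Against the adversary that always answers `V`, the
answer to a query `q = (i, j)` is `u i j` with probability `1 - ρ` and `V` with probability `ρ`. In
the rival world the utility at `q` is `V`, and corrupted answers to `q` are `u i j`. Only the law of
the answers to `q` changes there: its two weights are exchanged (`flippedAt_updateAt`). Each query
of `q` therefore carries information `flipDivergence ρ`, and every other query carries none.

If `j` is taken by another agent after the first turn of `i`, the rival world has a different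
round-robin allocation (`roundRobin_ne_roundRobin_updateAt`). A correct algorithm must tell the two
worlds apart, so in the world `u` it queries `q` in expectation at least `(1 - 2δ) log((1 - δ)/δ) /
flipDivergence ρ` times (`IsCorrect.le_mul_integral_queryCount`, in the limit of large times). The
adversary in the world `u` is the same for all `q`, so these bounds add up over the sensitive pairs,
of which there are at least `nm/4` (`mul_le_four_mul_card_sensitivePairs`).

The change of measure (`integral_log_sub_le_log_integral`) is Jensen's inequality for the logarithm,
applied one step at a time. -/

/-- The state after `T` steps of the recursion `x ↦ σ x (b t)` started at `x₀`. -/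
def chain {X : Type*} (σ : X → Bool → X) (x₀ : X) (b : ℕ → Bool) : ℕ → X
  | 0 => x₀
  | T + 1 => σ (chain σ x₀ b T) (b T)

/-- The expectation of `φ` after one step from `x`. -/
noncomputable def stepMean {X : Type*} (ρ : ℝ) (σ : X → Bool → X) (φ : X → ℝ) (x : X) : ℝ :=
  ρ * φ (σ x true) + (1 - ρ) * φ (σ x false)

/-- Factoring through finitely many bits gives integrability and independence from the bit `b T`
without any measurable structure on the state space. -/
lemma exists_chain_eq_restrict {X : Type*} (σ : X → Bool → X) (x₀ : X) (T : ℕ) :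
    ∃ g : (Finset.range T → Bool) → X, ∀ b, chain σ x₀ b T = g (fun i => b i) := by
  induction T with
  | zero => exact ⟨fun _ => x₀, fun _ => rfl⟩
  | succ T ih =>
    obtain ⟨g, hg⟩ := ih
    refine ⟨fun y => σ (g fun i => y ⟨i, Finset.mem_range.2
      ((Finset.mem_range.1 i.2).trans T.lt_succ_self)⟩) (y ⟨T, Finset.self_mem_range_succ T⟩), ?_⟩
    intro b
    simp [chain, hg]

instance (ρ : unitInterval) : IsProbabilityMeasure (noiseLaw ρ) := by
  unfold noiseLaw; infer_instance

lemma integrable_chain {X : Type*} (ρ : unitInterval) (σ : X → Bool → X) (x₀ : X) (φ : X → ℝ)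
    (T : ℕ) : Integrable (fun b => φ (chain σ x₀ b T)) (noiseLaw ρ) := by
  obtain ⟨g, hg⟩ := exists_chain_eq_restrict σ x₀ T
  simp_rw [hg]
  have hm : Measurable fun (b : ℕ → Bool) (i : Finset.range T) => b i := by fun_prop
  exact (Integrable.of_finite (f := fun y => φ (g y))
    (μ := (noiseLaw ρ).map fun (b : ℕ → Bool) (i : Finset.range T) => b i)).comp_measurable hm

lemma integral_chain_mul_coordinate {X : Type*} (ρ : unitInterval) (σ : X → Bool → X) (x₀ : X)
    (φ : X → ℝ) (χ : Bool → ℝ) (T : ℕ) :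
    ∫ b, φ (chain σ x₀ b T) * χ (b T) ∂(noiseLaw ρ) =
      (∫ b, φ (chain σ x₀ b T) ∂(noiseLaw ρ)) * (ρ * χ true + (1 - ρ) * χ false) := by
  obtain ⟨g, hg⟩ := exists_chain_eq_restrict σ x₀ T
  simp_rw [hg]
  have hind : iIndepFun (fun (i : ℕ) (b : ℕ → Bool) => b i) (noiseLaw ρ) :=
    iIndepFun_infinitePi (P := fun _ : ℕ => bernoulliMeasure true false ρ)
      (X := fun _ => id) (fun _ => measurable_id)
  have h2 := hind.indepFun_finset (Finset.range T) {T} (by simp) (fun i => measurable_pi_apply i)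
  have h3 := h2.comp (φ := fun y => φ (g y))
    (ψ := fun y : (({T} : Finset ℕ) → Bool) => χ (y ⟨T, Finset.mem_singleton_self T⟩))
    Measurable.of_discrete Measurable.of_discrete
  have h4 := h3.integral_fun_mul_eq_mul_integral
    (Measurable.aestronglyMeasurable (Measurable.of_discrete.comp (by fun_prop)))
    (Measurable.aestronglyMeasurable (Measurable.of_discrete.comp (by fun_prop)))
  simp only [Function.comp_def] at h4
  rw [h4]
  congr 1
  have h5 := (measurePreserving_eval_infinitePi (fun _ : ℕ => bernoulliMeasure true false ρ) T)
  have h6 := integral_map (μ := noiseLaw ρ) (φ := fun b : ℕ → Bool => b T) (f := χ)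
    (measurable_pi_apply T).aemeasurable Measurable.of_discrete.aestronglyMeasurable
  rw [← h6]
  have h7 : (noiseLaw ρ).map (fun b : ℕ → Bool => b T) = bernoulliMeasure true false ρ := h5.map_eq
  rw [h7, integral_bernoulliMeasure]
  simp

lemma integral_chain_succ {X : Type*} (ρ : unitInterval) (σ : X → Bool → X) (x₀ : X)
    (φ : X → ℝ) (T : ℕ) :
    ∫ b, φ (chain σ x₀ b (T + 1)) ∂(noiseLaw ρ) =
      ∫ b, stepMean ρ σ φ (chain σ x₀ b T) ∂(noiseLaw ρ) := by
  have h (b : ℕ → Bool) : φ (chain σ x₀ b (T + 1)) =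
      φ (σ (chain σ x₀ b T) true) * (if b T then 1 else 0) +
      φ (σ (chain σ x₀ b T) false) * (if b T then 0 else 1) := by
    cases hb : b T <;> simp [chain, hb]
  have hi (c : Bool) (χ : Bool → ℝ) :
      Integrable (fun b => φ (σ (chain σ x₀ b T) c) * χ (b T)) (noiseLaw ρ) := by
    -- The product is itself a function of a chain: the state is enlarged by a second component that
    -- stores its latest value.
    have := integrable_chain ρ (fun (y : X × ℝ) d => (σ y.1 d, φ (σ y.1 c) * χ d)) (x₀, 0)
      Prod.snd (T + 1)
    have e (b : ℕ → Bool) (t : ℕ) : (chain (fun (y : X × ℝ) d => (σ y.1 d, φ (σ y.1 c) * χ d))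
        (x₀, 0) b t).1 = chain σ x₀ b t := by
      induction t with
      | zero => rfl
      | succ t ih => simp [chain, ih]
    simpa [chain, e] using this
  simp_rw [h]
  rw [integral_add (hi true fun d => if d then 1 else 0) (hi false fun d => if d then 0 else 1),
    integral_chain_mul_coordinate ρ σ x₀ (fun x => φ (σ x true)) (fun d => if d then 1 else 0),
    integral_chain_mul_coordinate ρ σ x₀ (fun x => φ (σ x false)) (fun d => if d then 0 else 1)]
  unfold stepMean
  rw [integral_add ((integrable_chain ρ σ x₀ (fun x => φ (σ x true)) T).const_mul _)
    ((integrable_chain ρ σ x₀ (fun x => φ (σ x false)) T).const_mul _),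
    integral_const_mul, integral_const_mul]
  simp
  ring

/-- The Kullback-Leibler divergence between the Bernoulli laws of parameters `ρ` and `1 - ρ`. -/
noncomputable def flipDivergence (ρ : ℝ) : ℝ := (1 - 2 * ρ) * Real.log ((1 - ρ) / ρ)

lemma flipDivergence_pos {ρ : ℝ} (h0 : 0 < ρ) (h1 : ρ < 1 / 2) : 0 < flipDivergence ρ := by
  refine mul_pos (by linarith) (Real.log_pos ?_)
  rw [lt_div_iff₀ h0]; linarith

lemma mul_log_add_mul_log_le {ρ x y : ℝ} (h0 : 0 < ρ) (h1 : ρ < 1) (hx : 0 < x) (hy : 0 < y) :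
    ρ * Real.log x + (1 - ρ) * Real.log y ≤ Real.log (ρ * x + (1 - ρ) * y) := by
  have := strictConcaveOn_log_Ioi.concaveOn.2 (x := x) (y := y) hx hy h0.le
    (sub_pos.2 h1).le (by ring)
  simpa using this

/-- Jensen's inequality after weighting `x` and `y` by the likelihood ratios `(1 - ρ)/ρ` and `ρ/(1 -
ρ)`; the mean logarithm of these weights is `-flipDivergence ρ`. -/
lemma mul_log_add_mul_log_sub_le_flip {ρ x y : ℝ} (h0 : 0 < ρ) (h1 : ρ < 1) (hx : 0 < x)
    (hy : 0 < y) : ρ * Real.log x + (1 - ρ) * Real.log y - flipDivergence ρ ≤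
      Real.log (ρ * y + (1 - ρ) * x) := by
  have h1' : 0 < 1 - ρ := sub_pos.2 h1
  have := mul_log_add_mul_log_le h0 h1 (x := (1 - ρ) / ρ * x) (y := ρ / (1 - ρ) * y)
    (by positivity) (by positivity)
  rw [Real.log_mul (by positivity) hx.ne', Real.log_mul (by positivity) hy.ne',
    show ρ * ((1 - ρ) / ρ * x) + (1 - ρ) * (ρ / (1 - ρ) * y) = ρ * y + (1 - ρ) * x by
      field_simp; ring,
    ← inv_div (1 - ρ) ρ, Real.log_inv] at this
  unfold flipDivergence
  linarith

/-- Comparison of a chain with the chain in which the noise is flipped on the states in `D`: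
the price for the change of measure is `flipDivergence ρ` for each visit to `D`. -/
lemma integral_log_sub_le_log_integral {X : Type*} (ρ : unitInterval) (h0 : 0 < (ρ : ℝ))
    (h1 : (ρ : ℝ) < 1) (σ σ' : X → Bool → X) (D : Set X) (N : X → ℝ)
    (hσ : ∀ x ∉ D, σ' x = σ x) (hσ' : ∀ x ∈ D, ∀ a, σ' x a = σ x (!a))
    (hN : ∀ x ∉ D, ∀ a, N (σ x a) = N x) (hN' : ∀ x ∈ D, ∀ a, N (σ x a) = N x + 1)
    (x₀ : X) (hx₀ : N x₀ = 0) (T : ℕ) (φ : X → ℝ) (hφ : ∀ x, 0 < φ x) :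
    ∫ b, (Real.log (φ (chain σ x₀ b T)) - flipDivergence ρ * N (chain σ x₀ b T)) ∂(noiseLaw ρ) ≤
      Real.log (∫ b, φ (chain σ' x₀ b T) ∂(noiseLaw ρ)) := by
  -- The last step is integrated out: the induction hypothesis is applied to the one-step mean of
  -- `φ` under `σ'`, so `φ` has to vary.
  induction T generalizing φ with
  | zero => simp [chain, hx₀]
  | succ T ih =>
    have h1' : 0 < 1 - (ρ : ℝ) := sub_pos.2 h1
    rw [integral_chain_succ ρ σ' x₀ φ,
      integral_chain_succ ρ σ x₀ (fun x => Real.log (φ x) - flipDivergence ρ * N x)]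
    refine le_trans (integral_mono (integrable_chain ρ σ x₀ _ T)
      (integrable_chain ρ σ x₀
        (fun x => Real.log (stepMean ρ σ' φ x) - flipDivergence ρ * N x) T) fun b => ?_)
      (ih (stepMean ρ σ' φ) fun x => ?_)
    · dsimp only
      generalize chain σ x₀ b T = x
      by_cases hx : x ∈ D
      · have := mul_log_add_mul_log_sub_le_flip h0 h1 (hφ (σ x true)) (hφ (σ x false))
        simp only [stepMean, hσ' x hx, hN' x hx, Bool.not_true, Bool.not_false]
        linarith
      · have := mul_log_add_mul_log_le h0 h1 (hφ (σ x true)) (hφ (σ x false))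
        simp only [stepMean, hσ x hx, hN x hx]
        linarith
    · have := hφ (σ' x true)
      have := hφ (σ' x false)
      unfold stepMean
      positivity

/-! ### Runs of an algorithm as chains -/

variable {n m : ℕ}

/-- The history after one more step, where `a` says whether the answer is corrupted. -/
def step (s : DetAlgorithm n m) (u : Fin n → Fin m → ℝ) (adv : Adversary n m)
    (h : History n m) (a : Bool) : History n m :=
  match s h with
  | Sum.inl q => h ++ [(q, answer u adv h q a)]
  | Sum.inr _ => h

lemma step_of_inl {s : DetAlgorithm n m} {h : History n m} {q : Query n m} (hs : s h = Sum.inl q)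
    (u : Fin n → Fin m → ℝ) (adv : Adversary n m) (a : Bool) :
    step s u adv h a = h ++ [(q, answer u adv h q a)] := by
  simp [step, hs]

lemma step_of_inr {s : DetAlgorithm n m} {h : History n m} {A : Allocation n m}
    (hs : s h = Sum.inr A) (u : Fin n → Fin m → ℝ) (adv : Adversary n m) (a : Bool) :
    step s u adv h a = h := by
  simp [step, hs]

lemma historyAt_succ (s : DetAlgorithm n m) (u : Fin n → Fin m → ℝ) (adv : Adversary n m)
    (b : ℕ → Bool) (T : ℕ) :
    historyAt s u adv b (T + 1) = step s u adv (historyAt s u adv b T) (b T) := by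
  cases hs : s (historyAt s u adv b T) <;> simp [historyAt, step, hs]

lemma historyAt_eq_chain (s : DetAlgorithm n m) (u : Fin n → Fin m → ℝ) (adv : Adversary n m)
    (b : ℕ → Bool) (T : ℕ) : historyAt s u adv b T = chain (step s u adv) [] b T := by
  induction T with
  | zero => rfl
  | succ T ih => rw [historyAt_succ, ih, chain]

lemma historyAt_eq_of_stop {s : DetAlgorithm n m} {u : Fin n → Fin m → ℝ} {adv : Adversary n m}
    {b : ℕ → Bool} {T T' : ℕ} {A : Allocation n m} (hs : s (historyAt s u adv b T) = Sum.inr A)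
    (hT : T ≤ T') : historyAt s u adv b T' = historyAt s u adv b T := by
  induction hT with
  | refl => rfl
  | step _ ih => rw [historyAt_succ, ih, step_of_inr hs]

lemma length_historyAt_le (s : DetAlgorithm n m) (u : Fin n → Fin m → ℝ) (adv : Adversary n m)
    (b : ℕ → Bool) (T : ℕ) : (historyAt s u adv b T).length ≤ T := by
  induction T with
  | zero => simp [historyAt]
  | succ T ih =>
    rw [historyAt_succ, step]
    split
    · simpa using ih
    · omega

/-- The number of times that `q` is queried in a history. -/
def queryCount (q : Query n m) (h : History n m) : ℕ := h.countP fun p => p.1 = q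

lemma sum_queryCount_le_length (B : Finset (Query n m)) (h : History n m) :
    ∑ q ∈ B, queryCount q h ≤ h.length := by
  induction h with
  | nil => simp [queryCount]
  | cons p h ih =>
    have (q : Query n m) : queryCount q (p :: h) = queryCount q h + if p.1 = q then 1 else 0 := by
      simp [queryCount, List.countP_cons]
    simp only [this, Finset.sum_add_distrib, Finset.sum_ite_eq, List.length_cons]
    split <;> omega

lemma queryCount_le_length (q : Query n m) (h : History n m) : queryCount q h ≤ h.length :=
  List.countP_le_length

/-- The answers in the two worlds have the same distribution, except that for the query `q` the
roles of the true and of the corrupted answer are exchanged. -/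
structure FlippedAt (q : Query n m) (u : Fin n → Fin m → ℝ) (adv : Adversary n m)
    (u' : Fin n → Fin m → ℝ) (adv' : Adversary n m) : Prop where
  eq_of_ne : ∀ h p a, p ≠ q → answer u' adv' h p a = answer u adv h p a
  flip : ∀ h a, answer u' adv' h q a = answer u adv h q (!a)

/-- Here `D` is the set of histories after which `q` is queried. The bound `log x ≤ x - 1` makes the
right-hand side linear, so that the inequality can be averaged over the seed. -/
lemma integral_log_sub_le_integral_sub_one (ρ : unitInterval) (h0 : 0 < (ρ : ℝ))
    (h1 : (ρ : ℝ) < 1) (s : DetAlgorithm n m) {q : Query n m} {u u' : Fin n → Fin m → ℝ}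
    {adv adv' : Adversary n m} (hf : FlippedAt q u adv u' adv') (T : ℕ) (φ : History n m → ℝ)
    {ε : ℝ} (hε : 0 < ε) (hφ : ∀ h, ε ≤ φ h) :
    ∫ b, (Real.log (φ (historyAt s u adv b T)) -
        flipDivergence ρ * queryCount q (historyAt s u adv b T)) ∂(noiseLaw ρ) ≤
      ∫ b, φ (historyAt s u' adv' b T) ∂(noiseLaw ρ) - 1 := by
  simp_rw [historyAt_eq_chain]
  refine le_trans (integral_log_sub_le_log_integral ρ h0 h1 (step s u adv) (step s u' adv')
    {h | s h = Sum.inl q} (fun h => queryCount q h) ?_ ?_ ?_ ?_ [] (by simp [queryCount]) T φ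
    fun h => hε.trans_le (hφ h)) (Real.log_le_sub_one_of_pos ?_)
  · intro h hh
    ext1 a
    cases hs : s h with
    | inl p =>
      rw [step_of_inl hs, step_of_inl hs, hf.eq_of_ne h p a]
      rintro rfl
      exact hh hs
    | inr A => rw [step_of_inr hs, step_of_inr hs]
  · intro h hh a
    rw [step_of_inl hh, step_of_inl hh, hf.flip]
  · intro h hh a
    cases hs : s h with
    | inl p =>
      have : p ≠ q := by
        rintro rfl
        exact hh hs
      rw [step_of_inl hs]
      simp [queryCount, this]
    | inr A => rw [step_of_inr hs]
  · intro h hh a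
    rw [step_of_inl hh]
    simp [queryCount]
  · refine hε.trans_le ?_
    have := integral_mono (integrable_const ε)
      (integrable_chain ρ (step s u' adv') [] φ T) fun b => hφ _
    simpa using this

/-! ### Joint measurability in the seed and the noise -/

namespace RandAlgorithm

variable (alg : RandAlgorithm n m)

instance (ρ : unitInterval) : IsProbabilityMeasure (alg.law ρ) := by
  unfold law; infer_instance

/-- There are uncountably many histories, so the event is not split according to the history.
Instead `D` is pulled back through one step at a time, and each step has only finitely many outcomes
for a given history and noise bit. -/
lemma measurableSet_mem_historyAt (u : Fin n → Fin m → ℝ) (adv : Adversary n m) (T : ℕ)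
    (D : History n m → Set alg.Seed) (hD : ∀ h, MeasurableSet (D h)) :
    MeasurableSet {x : alg.Seed × (ℕ → Bool) |
      x.1 ∈ D (historyAt (alg.strategy x.1) u adv x.2 T)} := by
  induction T generalizing D with
  | zero => exact measurable_fst (hD [])
  | succ T ih =>
    let E (c : Bool) (h : History n m) : Set alg.Seed :=
      (⋃ q : Query n m, {r | alg.strategy r h = Sum.inl q} ∩ D (h ++ [(q, answer u adv h q c)])) ∪
      ⋃ A : Allocation n m, {r | alg.strategy r h = Sum.inr A} ∩ D h
    have hE (c : Bool) (h : History n m) : MeasurableSet (E c h) :=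
      (MeasurableSet.iUnion fun q => (alg.measurableSet_strategy h _).inter (hD _)).union
        (MeasurableSet.iUnion fun A => (alg.measurableSet_strategy h _).inter (hD _))
    have hmem (c : Bool) (h : History n m) (r : alg.Seed) :
        r ∈ D (step (alg.strategy r) u adv h c) ↔ r ∈ E c h := by
      cases hs : alg.strategy r h with
      | inl q => simp [E, step_of_inl hs, hs]
      | inr A => simp [E, step_of_inr hs, hs]
    have hset : {x : alg.Seed × (ℕ → Bool) |
        x.1 ∈ D (historyAt (alg.strategy x.1) u adv x.2 (T + 1))} =
        ⋃ c : Bool, {x : alg.Seed × (ℕ → Bool) | x.2 T = c} ∩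
          {x | x.1 ∈ E c (historyAt (alg.strategy x.1) u adv x.2 T)} := by
      ext x
      simp [historyAt_succ, hmem]
    rw [hset]
    refine MeasurableSet.iUnion fun c => MeasurableSet.inter ?_ (ih _ (hE c))
    exact (measurableSet_singleton c).preimage ((measurable_pi_apply T).comp measurable_snd)

lemma measurable_comp_historyAt (u : Fin n → Fin m → ℝ) (adv : Adversary n m) (T : ℕ)
    (f : History n m → ℕ) :
    Measurable fun x : alg.Seed × (ℕ → Bool) => f (historyAt (alg.strategy x.1) u adv x.2 T) := by
  refine measurable_to_countable' fun k => ?_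
  convert alg.measurableSet_mem_historyAt u adv T (fun h => {_r | f h = k})
    (fun h => MeasurableSet.const _) using 1
  rfl

/-- The event that the algorithm has output `A` by time `T`. -/
def outputBy (u : Fin n → Fin m → ℝ) (adv : Adversary n m) (A : Allocation n m) (T : ℕ) :
    Set (alg.Seed × (ℕ → Bool)) :=
  {x | alg.strategy x.1 (historyAt (alg.strategy x.1) u adv x.2 T) = Sum.inr A}

lemma measurableSet_outputBy (u : Fin n → Fin m → ℝ) (adv : Adversary n m) (A : Allocation n m)
    (T : ℕ) : MeasurableSet (alg.outputBy u adv A T) :=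
  alg.measurableSet_mem_historyAt u adv T (fun h => {r | alg.strategy r h = Sum.inr A})
    fun h => alg.measurableSet_strategy h _

lemma monotone_outputBy (u : Fin n → Fin m → ℝ) (adv : Adversary n m) (A : Allocation n m) :
    Monotone (alg.outputBy u adv A) := by
  intro T T' hT x hx
  have := historyAt_eq_of_stop hx hT
  simpa [outputBy, this] using hx

lemma setOf_outputs_eq_iUnion (u : Fin n → Fin m → ℝ) (adv : Adversary n m) (A : Allocation n m) :
    {x | Outputs (alg.strategy x.1) u adv x.2 A} = ⋃ T, alg.outputBy u adv A T := by
  ext x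
  simp [Outputs, outputBy]

/-- A stopped run never changes, so it has at most one output. -/
lemma disjoint_outputBy (u : Fin n → Fin m → ℝ) (adv : Adversary n m) {A A' : Allocation n m}
    (hA : A ≠ A') (T : ℕ) :
    Disjoint (alg.outputBy u adv A T) {x | Outputs (alg.strategy x.1) u adv x.2 A'} := by
  rw [Set.disjoint_left]
  rintro x hx ⟨T', hx'⟩
  have h1 := alg.monotone_outputBy u adv A (le_max_left T T') hx
  have h2 := alg.monotone_outputBy u adv A' (le_max_right T T')
    (show x ∈ alg.outputBy u adv A' T' from hx')
  exact hA (Sum.inr.inj (h1.symm.trans h2))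

variable {alg} {ρ : unitInterval}

lemma tendsto_real_outputBy (u : Fin n → Fin m → ℝ) (adv : Adversary n m) (A : Allocation n m) :
    Filter.Tendsto (fun T => (alg.law ρ).real (alg.outputBy u adv A T)) Filter.atTop
      (nhds ((alg.law ρ).real {x | Outputs (alg.strategy x.1) u adv x.2 A})) := by
  rw [setOf_outputs_eq_iUnion]
  exact (ENNReal.tendsto_toReal (measure_ne_top _ _)).comp
    (tendsto_measure_iUnion_atTop (alg.monotone_outputBy u adv A))

lemma IsCorrect.one_sub_le_real {δ : ℝ} (hc : alg.IsCorrect ρ δ) (adv : Adversary n m)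
    {u : Fin n → Fin m → ℝ} (hu : IsUtilityProfile u) :
    1 - δ ≤ (alg.law ρ).real {x | Outputs (alg.strategy x.1) u adv x.2 (roundRobin u)} :=
  (ENNReal.ofReal_le_iff_le_toReal (measure_ne_top _ _)).1 (hc adv u hu)

lemma IsCorrect.real_outputBy_le {δ : ℝ} (hc : alg.IsCorrect ρ δ) (adv : Adversary n m)
    {u : Fin n → Fin m → ℝ} (hu : IsUtilityProfile u) {A : Allocation n m}
    (hA : A ≠ roundRobin u) (T : ℕ) : (alg.law ρ).real (alg.outputBy u adv A T) ≤ δ := by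
  have h1 := hc.one_sub_le_real adv hu
  have h2 := measureReal_union' (μ := alg.law ρ) (alg.disjoint_outputBy u adv hA T)
    (alg.measurableSet_outputBy u adv A T)
  have h3 : (alg.law ρ).real (alg.outputBy u adv A T ∪
      {x | Outputs (alg.strategy x.1) u adv x.2 (roundRobin u)}) ≤ 1 := measureReal_le_one
  linarith

lemma integrable_queryCount (u : Fin n → Fin m → ℝ) (adv : Adversary n m) (T : ℕ)
    (q : Query n m) : Integrable (fun x : alg.Seed × (ℕ → Bool) =>
      (queryCount q (historyAt (alg.strategy x.1) u adv x.2 T) : ℝ)) (alg.law ρ) := by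
  refine Integrable.of_bound (C := T) (Measurable.aestronglyMeasurable
    (measurable_from_nat.comp (alg.measurable_comp_historyAt u adv T (queryCount q)))) ?_
  refine Filter.Eventually.of_forall fun x => ?_
  rw [Real.norm_of_nonneg (Nat.cast_nonneg _), Nat.cast_le]
  exact (queryCount_le_length _ _).trans (length_historyAt_le _ _ _ _ _)

open Classical in
/-- The queries of `q` that are needed to tell two worlds apart that differ only in `q` but have
different round-robin allocations. -/
lemma IsCorrect.le_mul_integral_queryCount (h0 : 0 < (ρ : ℝ)) (h1 : (ρ : ℝ) < 1) {δ : ℝ}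
    (hδ0 : 0 < δ) (hδ1 : δ < 1 / 2) (hc : alg.IsCorrect ρ δ) {q : Query n m}
    {u u' : Fin n → Fin m → ℝ} {adv adv' : Adversary n m} (hf : FlippedAt q u adv u' adv')
    (hu' : IsUtilityProfile u') (hne : roundRobin u ≠ roundRobin u') (T : ℕ) :
    Real.log ((1 - δ) / δ) *
        (2 * (alg.law ρ).real (alg.outputBy u adv (roundRobin u) T) - 1) ≤
      flipDivergence ρ *
        ∫ x, (queryCount q (historyAt (alg.strategy x.1) u adv x.2 T) : ℝ) ∂(alg.law ρ) := by
  set A := roundRobin u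
  set α := Real.log ((1 - δ) / δ) with hα
  have hδ' : 0 < 1 - δ := by linarith
  -- The test function is `γ` if the output is `A` and `β` otherwise, with logarithms `α` and `-α`.
  -- Its mean under an output probability of exactly `δ` is `1`, where `log x ≤ x - 1` is sharp.
  set β := δ / (1 - δ) with hβ
  set γ := (1 - δ) / δ with hγ
  have hβ0 : 0 < β := by positivity
  have hγβ : β ≤ γ := by
    rw [hβ, hγ, div_le_div_iff₀ hδ' hδ0]; nlinarith
  have hlogβ : Real.log β = -α := by rw [hα, hβ, ← inv_div, Real.log_inv]
  let E := alg.outputBy u adv A T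
  let E' := alg.outputBy u' adv' A T
  let I : alg.Seed × (ℕ → Bool) → ℝ := E.indicator 1
  let I' : alg.Seed × (ℕ → Bool) → ℝ := E'.indicator 1
  let N : alg.Seed × (ℕ → Bool) → ℝ :=
    fun x => queryCount q (historyAt (alg.strategy x.1) u adv x.2 T)
  have hE : MeasurableSet E := alg.measurableSet_outputBy u adv A T
  have hE' : MeasurableSet E' := alg.measurableSet_outputBy u' adv' A T
  have hI : Integrable I (alg.law ρ) := (integrable_const 1).indicator hE
  have hI' : Integrable I' (alg.law ρ) := (integrable_const 1).indicator hE'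
  have hN : Integrable N (alg.law ρ) := integrable_queryCount u adv T q
  let f : alg.Seed × (ℕ → Bool) → ℝ := fun x => (2 * α * I x - α) - flipDivergence ρ * N x
  let g : alg.Seed × (ℕ → Bool) → ℝ := fun x => (γ - β) * I' x + (β - 1)
  have hfi1 : Integrable (fun x => 2 * α * I x - α) (alg.law ρ) :=
    (hI.const_mul _).sub (integrable_const _)
  have hfi : Integrable f (alg.law ρ) := hfi1.sub (hN.const_mul _)
  have hgi : Integrable g (alg.law ρ) := (hI'.const_mul _).add (integrable_const _)
  have key : ∫ x, f x ∂(alg.law ρ) ≤ ∫ x, g x ∂(alg.law ρ) := by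
    unfold law at hfi hgi ⊢
    rw [integral_prod f hfi, integral_prod g hgi]
    refine integral_mono hfi.integral_prod_left hgi.integral_prod_left fun r => ?_
    have h := integral_log_sub_le_integral_sub_one ρ h0 h1 (alg.strategy r) hf T
      (fun h => if alg.strategy r h = Sum.inr A then γ else β) hβ0
      (fun h => by split_ifs; exacts [hγβ, le_rfl])
    have hi := integrable_chain ρ (step (alg.strategy r) u' adv') []
      (fun h => if alg.strategy r h = Sum.inr A then γ else β) T
    simp_rw [← historyAt_eq_chain] at hi
    have e2 : ∫ b, g (r, b) ∂(noiseLaw ρ) = ∫ b, (if alg.strategy r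
        (historyAt (alg.strategy r) u' adv' b T) = Sum.inr A then γ else β) ∂(noiseLaw ρ) - 1 := by
      have e3 : (1 : ℝ) = ∫ b : ℕ → Bool, (1 : ℝ) ∂(noiseLaw ρ) := by simp
      conv_rhs => rw [e3]
      rw [← integral_sub hi (integrable_const 1)]
      refine integral_congr_ae (Filter.Eventually.of_forall fun b => ?_)
      by_cases hb : alg.strategy r (historyAt (alg.strategy r) u' adv' b T) = Sum.inr A <;>
        simp [g, I', E', outputBy, Set.indicator, hb]
    rw [e2]
    refine le_trans (le_of_eq (integral_congr_ae (Filter.Eventually.of_forall fun b => ?_))) h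
    by_cases hb : alg.strategy r (historyAt (alg.strategy r) u adv b T) = Sum.inr A
    · simp [f, I, E, outputBy, Set.indicator, hb, N, ← hα]
      ring
    · simp [f, I, E, outputBy, Set.indicator, hb, N, hlogβ]
  have ef : ∫ x, f x ∂(alg.law ρ) =
      2 * α * (alg.law ρ).real E - α - flipDivergence ρ * ∫ x, N x ∂(alg.law ρ) := by
    rw [integral_sub hfi1 (hN.const_mul _), integral_sub (hI.const_mul _) (integrable_const _),
      integral_const_mul, integral_const_mul, integral_indicator_one hE]
    simp
  have eg : ∫ x, g x ∂(alg.law ρ) = (γ - β) * (alg.law ρ).real E' + (β - 1) := by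
    rw [integral_add (hI'.const_mul _) (integrable_const _),
      integral_const_mul, integral_indicator_one hE']
    simp
  -- In the rival world `A` is a wrong output.
  have hq : (alg.law ρ).real E' ≤ δ := hc.real_outputBy_le adv' hu' hne T
  have h2 : (γ - β) * (alg.law ρ).real E' + (β - 1) ≤ 0 := by
    have h3 : (γ - β) * (alg.law ρ).real E' ≤ (γ - β) * δ :=
      mul_le_mul_of_nonneg_left hq (sub_nonneg.2 hγβ)
    have h4 : (γ - β) * δ + (β - 1) = 0 := by
      rw [hγ, hβ]; field_simp; ring
    linarith
  rw [ef, eg] at key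
  change α * (2 * (alg.law ρ).real E - 1) ≤ flipDivergence ρ * ∫ x, N x ∂(alg.law ρ)
  linarith

end RandAlgorithm

/-! ### The round-robin allocation -/

lemma IsFavorite.eq {v : Fin m → ℝ} (hv : Function.Injective v) {S : Finset (Fin m)}
    {j k : Fin m} (hj : IsFavorite v S j) (hk : IsFavorite v S k) : j = k :=
  hv (le_antisymm (hk.2 j hj.1) (hj.2 k hk.1))

lemma exists_isFavorite (v : Fin m → ℝ) {S : Finset (Fin m)} (hS : S.Nonempty) :
    ∃ j, IsFavorite v S j := by
  obtain ⟨j, hj, h⟩ := S.exists_max_image v hS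
  exact ⟨j, hj, h⟩

lemma mem_remaining_succ (u : Fin n → Fin m → ℝ) (t : ℕ) (j : Fin m) :
    j ∈ remaining u (t + 1) ↔ j ∈ remaining u t ∧
      ¬ ∃ i : Fin n, (i : ℕ) = t % n ∧ IsFavorite (u i) (remaining u t) j := by
  classical
  rw [remaining, Finset.mem_filter]

lemma remaining_antitone (u : Fin n → Fin m → ℝ) : Antitone (remaining u) :=
  antitone_nat_of_succ_le fun t _ hj => ((mem_remaining_succ u t _).1 hj).1

lemma notMem_remaining_of_isFavorite {u : Fin n → Fin m → ℝ} {s t : ℕ} {i : Fin n} {j : Fin m}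
    (hi : (i : ℕ) = s % n) (hj : IsFavorite (u i) (remaining u s) j) (hst : s < t) :
    j ∉ remaining u t := fun h =>
  ((mem_remaining_succ u s j).1 (remaining_antitone u hst h)).2 ⟨i, hi, hj⟩

lemma turn_eq_of_isFavorite {u : Fin n → Fin m → ℝ} {s t : ℕ} {i k : Fin n} {j : Fin m}
    (hi : (i : ℕ) = s % n) (hj : IsFavorite (u i) (remaining u s) j)
    (hk : (k : ℕ) = t % n) (hj' : IsFavorite (u k) (remaining u t) j) : s = t := by
  rcases lt_trichotomy s t with h | h | h
  · exact absurd hj'.1 (notMem_remaining_of_isFavorite hi hj h)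
  · exact h
  · exact absurd hj.1 (notMem_remaining_of_isFavorite hk hj' h)

/-- Without ties the favorite is unique, so a turn removes at most one item. -/
lemma le_card_remaining_succ {u : Fin n → Fin m → ℝ} (hu : IsUtilityProfile u) (t : ℕ) :
    (remaining u t).card ≤ (remaining u (t + 1)).card + 1 := by
  classical
  have h : (remaining u t \ remaining u (t + 1)).card ≤ 1 := by
    rw [Finset.card_le_one]
    intro a ha b hb
    rw [Finset.mem_sdiff, mem_remaining_succ, not_and, not_not] at ha hb
    obtain ⟨i, hi, hia⟩ := ha.2 ha.1
    obtain ⟨k, hk, hkb⟩ := hb.2 hb.1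
    obtain rfl : i = k := Fin.ext (hi.trans hk.symm)
    exact hia.eq (hu.injective i) hkb
  have := Finset.card_sdiff_add_card (remaining u t) (remaining u (t + 1))
  have h2 : (remaining u t).card ≤ (remaining u t ∪ remaining u (t + 1)).card :=
    Finset.card_le_card Finset.subset_union_left
  omega

lemma le_card_remaining_add {u : Fin n → Fin m → ℝ} (hu : IsUtilityProfile u) (t : ℕ) :
    m ≤ (remaining u t).card + t := by
  induction t with
  | zero => simp [remaining]
  | succ t ih =>
    have := le_card_remaining_succ hu t
    omega

lemma exists_taken {u : Fin n → Fin m → ℝ} (hu : IsUtilityProfile u) (hn : 0 < n) {t : ℕ}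
    (ht : t < m) : ∃ j, IsFavorite (u ⟨t % n, Nat.mod_lt _ hn⟩) (remaining u t) j := by
  have := le_card_remaining_add hu t
  exact exists_isFavorite _ (Finset.card_pos.1 (by omega))

/-- `u` with the utility for the single pair `q` replaced by `V`. -/
def updateAt (u : Fin n → Fin m → ℝ) (q : Query n m) (V : ℝ) : Fin n → Fin m → ℝ :=
  fun i j => if (i, j) = q then V else u i j

lemma updateAt_self (u : Fin n → Fin m → ℝ) (q : Query n m) (V : ℝ) :
    updateAt u q V q.1 q.2 = V := by
  simp [updateAt]

lemma updateAt_of_ne (u : Fin n → Fin m → ℝ) {q : Query n m} (V : ℝ) {i : Fin n} {j : Fin m}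
    (h : (i, j) ≠ q) : updateAt u q V i j = u i j := by
  simp [updateAt, h]

lemma IsUtilityProfile.updateAt {u : Fin n → Fin m → ℝ} (hu : IsUtilityProfile u)
    (q : Query n m) {V : ℝ} (hV0 : 0 ≤ V) (hV : ∀ i j, u i j < V) :
    IsUtilityProfile (updateAt u q V) where
  nonneg i j := by
    unfold RoundRobin.updateAt
    split_ifs
    exacts [hV0, hu.nonneg i j]
  injective i j k h := by
    unfold RoundRobin.updateAt at h
    split_ifs at h with h1 h2 h2
    · exact congrArg Prod.snd (h1.trans h2.symm)
    · exact absurd h (hV i k).ne'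
    · exact absurd h (hV i j).ne
    · exact hu.injective i h

/-- Agent `q.1` has her first turn at time `q.1`, and no earlier turn consults her utilities. -/
lemma remaining_updateAt (u : Fin n → Fin m → ℝ) (q : Query n m) (V : ℝ) {t : ℕ}
    (ht : t ≤ q.1) : remaining (updateAt u q V) t = remaining u t := by
  induction t with
  | zero => rfl
  | succ t ih =>
    ext j
    rw [mem_remaining_succ, mem_remaining_succ, ih (by omega)]
    have (i : Fin n) (hi : (i : ℕ) = t % n) : updateAt u q V i = u i := by
      ext k
      refine updateAt_of_ne u V fun h => ?_
      have h1 : i = q.1 := congrArg Prod.fst h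
      have h2 := Nat.mod_le t n
      rw [h1] at hi
      omega
    refine and_congr_right fun _ => not_congr (exists_congr fun i => and_congr_right fun hi => ?_)
    rw [this i hi]

/-- If an item is taken after the first turn of agent `i`, by another agent, then raising the
utility of `i` for that item above all others changes the round-robin allocation. -/
lemma roundRobin_ne_roundRobin_updateAt {u : Fin n → Fin m → ℝ} (hnm : n ≤ m) {t : ℕ}
    {i k : Fin n} {j : Fin m} (hk : (k : ℕ) = t % n)
    (hj : IsFavorite (u k) (remaining u t) j) (hit : (i : ℕ) < t) (hik : i ≠ k) {V : ℝ}
    (hV : ∀ i j, u i j < V) : roundRobin u ≠ roundRobin (updateAt u (i, j) V) := by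
  classical
  intro h
  -- With the raised utility, agent `i` takes `j` in her first turn, when `j` is still there.
  have h1 : j ∈ roundRobin (updateAt u (i, j) V) i := by
    refine Finset.mem_filter.2 ⟨Finset.mem_univ _, i, i.2.trans_le hnm,
      (Nat.mod_eq_of_lt i.2).symm, ?_⟩
    rw [remaining_updateAt u (i, j) V le_rfl]
    refine ⟨remaining_antitone u hit.le hj.1, fun l _ => ?_⟩
    rw [updateAt_self u (i, j) V]
    by_cases hl : (i, l) = (i, j)
    · simp [updateAt, hl]
    · rw [updateAt_of_ne u V hl]
      exact (hV i l).le
  rw [← h] at h1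
  -- Under `u` each item is taken in only one turn, and that turn belongs to `k`.
  obtain ⟨s, -, hs, hfav⟩ := (Finset.mem_filter.1 h1).2
  obtain rfl := turn_eq_of_isFavorite hs hfav hk hj
  exact hik (Fin.ext (hs.trans hk.symm))

/-- The agents that have had a turn before turn `t`, other than the agent whose turn it is. -/
def earlierAgents (n t : ℕ) : Finset ℕ := (Finset.range n).filter fun i => i < t ∧ i ≠ t % n

lemma card_earlierAgents_of_lt {t : ℕ} (ht : t < n) : (earlierAgents n t).card = t := by
  have : earlierAgents n t = Finset.range t := by
    ext i
    simp [earlierAgents, Nat.mod_eq_of_lt ht]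
    omega
  rw [this, Finset.card_range]

lemma card_earlierAgents_of_le (hn : 0 < n) {t : ℕ} (ht : n ≤ t) :
    (earlierAgents n t).card = n - 1 := by
  have : earlierAgents n t = (Finset.range n).erase (t % n) := by
    ext i
    simp [earlierAgents]
    omega
  rw [this, Finset.card_erase_of_mem (Finset.mem_range.2 (Nat.mod_lt _ hn)), Finset.card_range]

/-- The sum is `n(n - 1)/2 + (m - n)(n - 1)`, and `n ≤ 2(n - 1)`. -/
lemma mul_le_four_mul_sum_card_earlierAgents (hn : 2 ≤ n) (hnm : n ≤ m) :
    n * m ≤ 4 * ∑ t ∈ Finset.range m, (earlierAgents n t).card := by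
  induction m, hnm using Nat.le_induction with
  | base =>
    rw [Finset.sum_congr rfl fun t ht => card_earlierAgents_of_lt (Finset.mem_range.1 ht)]
    have := Finset.sum_range_id_mul_two n
    have h2 : n * n ≤ n * (2 * (n - 1)) := Nat.mul_le_mul_left n (by omega)
    nlinarith
  | succ m hm ih =>
    rw [Finset.sum_range_succ, card_earlierAgents_of_le (by omega) hm]
    have : n ≤ 4 * (n - 1) := by omega
    nlinarith

open Classical in
/-- The pairs `(i, j)` for which the item `j` is taken by another agent than `i`, after the first
turn of `i`. -/
noncomputable def sensitivePairs (u : Fin n → Fin m → ℝ) : Finset (Query n m) :=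
  Finset.univ.filter fun q => ∃ (t : ℕ) (k : Fin n), (k : ℕ) = t % n ∧
    IsFavorite (u k) (remaining u t) q.2 ∧ (q.1 : ℕ) < t ∧ q.1 ≠ k

lemma mul_le_four_mul_card_sensitivePairs {u : Fin n → Fin m → ℝ} (hu : IsUtilityProfile u)
    (hn : 2 ≤ n) (hnm : n ≤ m) : n * m ≤ 4 * (sensitivePairs u).card := by
  classical
  have hn0 : 0 < n := by omega
  have hm0 : 0 < m := by omega
  refine (mul_le_four_mul_sum_card_earlierAgents hn hnm).trans (Nat.mul_le_mul_left 4 ?_)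
  choose p hp using fun t : Fin m => exists_taken hu hn0 t.2
  -- A turn `t` and an earlier agent give a sensitive pair with the item taken at `t`. The
  -- remainders only make `F` total; on the relevant set they change nothing.
  let F : (Σ _ : ℕ, ℕ) → Query n m := fun x =>
    (⟨x.2 % n, Nat.mod_lt _ hn0⟩, p ⟨x.1 % m, Nat.mod_lt _ hm0⟩)
  rw [← Finset.card_sigma]
  have hmem (x : Σ _ : ℕ, ℕ) (hx : x ∈ (Finset.range m).sigma (earlierAgents n)) :
      x.1 < m ∧ x.2 < n ∧ x.2 < x.1 ∧ x.2 ≠ x.1 % n := by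
    simpa [earlierAgents] using hx
  refine Finset.card_le_card_of_injOn F (fun x hx => ?_) (fun x hx y hy hxy => ?_)
  · obtain ⟨h1, h2, h3, h4⟩ := hmem x hx
    refine Finset.mem_filter.2 ⟨Finset.mem_univ _, x.1, ⟨x.1 % n, Nat.mod_lt _ hn0⟩, rfl, ?_, ?_,
      ?_⟩
    · simpa [F, Nat.mod_eq_of_lt h1] using hp ⟨x.1, h1⟩
    · simpa [F, Nat.mod_eq_of_lt h2] using h3
    · simpa [F, Nat.mod_eq_of_lt h2] using h4
  · obtain ⟨h1, h2, -, -⟩ := hmem x hx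
    obtain ⟨h1', h2', -, -⟩ := hmem y hy
    simp only [F, Nat.mod_eq_of_lt h1, Nat.mod_eq_of_lt h2, Nat.mod_eq_of_lt h1',
      Nat.mod_eq_of_lt h2', Prod.mk.injEq, Fin.mk.injEq] at hxy
    have h5 : x.1 = y.1 := by
      have e1 := hp ⟨x.1, h1⟩
      rw [hxy.2] at e1
      exact turn_eq_of_isFavorite rfl e1 rfl (hp ⟨y.1, h1'⟩)
    obtain ⟨x1, x2⟩ := x
    obtain ⟨y1, y2⟩ := y
    simp_all

/-! ### The lower bound -/

/-- The adversary that answers every query by `V`. -/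
def constAdversary (V : ℝ) : Adversary n m := fun _ _ _ => V

/-- The adversary that answers the query `q` by `v`, and all others by `V`. -/
def constExceptAdversary (V v : ℝ) (q : Query n m) : Adversary n m :=
  fun _ _ p => if p = q then v else V

lemma flippedAt_updateAt (u : Fin n → Fin m → ℝ) (q : Query n m) (V : ℝ) :
    FlippedAt q u (constAdversary V) (updateAt u q V)
      (constExceptAdversary V (u q.1 q.2) q) where
  eq_of_ne h p a hp := by
    simp [answer, constAdversary, constExceptAdversary, hp, updateAt_of_ne u V hp]
  flip h a := by
    cases a <;> simp [answer, constAdversary, constExceptAdversary, updateAt_self]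

lemma exists_forall_lt (u : Fin n → Fin m → ℝ) : ∃ V : ℝ, 0 ≤ V ∧ ∀ i j, u i j < V := by
  obtain ⟨M, hM⟩ := (Set.finite_range fun q : Query n m => u q.1 q.2).bddAbove
  refine ⟨max 0 (M + 1), le_max_left _ _, fun i j => ?_⟩
  have : u i j ≤ M := hM ⟨(i, j), rfl⟩
  exact lt_max_of_lt_right (by linarith)

namespace RandAlgorithm

lemma IsCorrect.card_mul_le_mul_toReal_expectedQueries {alg : RandAlgorithm n m}
    {ρ : unitInterval} (h0 : 0 < (ρ : ℝ)) (h1 : (ρ : ℝ) < 1 / 2) {δ : ℝ}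
    (hδ0 : 0 < δ) (hδ1 : δ < 1 / 2) (hc : alg.IsCorrect ρ δ) (hnm : n ≤ m)
    {u : Fin n → Fin m → ℝ} (hu : IsUtilityProfile u) {V : ℝ} (hV0 : 0 ≤ V)
    (hV : ∀ i j, u i j < V) (htop : alg.expectedQueries ρ u (constAdversary V) ≠ ∞) :
    (sensitivePairs u).card * (Real.log ((1 - δ) / δ) * (1 - 2 * δ)) ≤
      flipDivergence ρ * (alg.expectedQueries ρ u (constAdversary V)).toReal := by
  classical
  have hlog : 0 ≤ Real.log ((1 - δ) / δ) := Real.log_nonneg (by rw [le_div_iff₀ hδ0]; linarith)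
  have hK := flipDivergence_pos h0 h1
  set adv : Adversary n m := constAdversary V
  have hT (T : ℕ) : (sensitivePairs u).card * (Real.log ((1 - δ) / δ) *
      (2 * (alg.law ρ).real (alg.outputBy u adv (roundRobin u) T) - 1)) ≤
      flipDivergence ρ * (alg.expectedQueries ρ u adv).toReal := by
    have e1 : (sensitivePairs u).card * (Real.log ((1 - δ) / δ) *
        (2 * (alg.law ρ).real (alg.outputBy u adv (roundRobin u) T) - 1)) ≤
        ∑ q ∈ sensitivePairs u, flipDivergence ρ *
          ∫ x, (queryCount q (historyAt (alg.strategy x.1) u adv x.2 T) : ℝ) ∂(alg.law ρ) := by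
      rw [← nsmul_eq_mul]
      refine Finset.card_nsmul_le_sum _ _ _ fun q hq => ?_
      obtain ⟨t, k, hk, hj, hit, hik⟩ := (Finset.mem_filter.1 hq).2
      exact hc.le_mul_integral_queryCount h0 (by linarith) hδ0 hδ1 (flippedAt_updateAt u q V)
        (hu.updateAt q hV0 hV) (roundRobin_ne_roundRobin_updateAt hnm hk hj hit hik hV) T
    refine e1.trans ?_
    rw [← Finset.mul_sum, ← integral_finsetSum _ fun q _ => integrable_queryCount u adv T q]
    refine mul_le_mul_of_nonneg_left ?_ hK.le
    rw [integral_eq_lintegral_of_nonneg_ae]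
    · refine ENNReal.toReal_mono htop (lintegral_mono fun x => ?_)
      rw [← Nat.cast_sum, ENNReal.ofReal_natCast]
      exact le_trans (Nat.cast_le.2 (sum_queryCount_le_length _ _))
        (le_iSup (fun t => ((historyAt (alg.strategy x.1) u adv x.2 t).length : ℝ≥0∞)) T)
    · exact Filter.Eventually.of_forall fun x => Finset.sum_nonneg fun _ _ => Nat.cast_nonneg _
    · exact (integrable_finsetSum _ fun q _ =>
        integrable_queryCount u adv T q).aestronglyMeasurable
  -- The right-hand side of `hT` does not depend on `T`. In the limit the probability is at least `1
  -- - δ`, which turns `2 * P - 1` into `1 - 2δ`.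
  have hlim := ((((tendsto_real_outputBy (ρ := ρ) (alg := alg) u adv (roundRobin u)).const_mul
    2).sub_const 1).const_mul (Real.log ((1 - δ) / δ))).const_mul ((sensitivePairs u).card : ℝ)
  refine le_trans ?_ (le_of_tendsto' hlim hT)
  have := hc.one_sub_le_real adv hu
  exact mul_le_mul_of_nonneg_left (mul_le_mul_of_nonneg_left (by linarith) hlog)
    (Nat.cast_nonneg _)

end RandAlgorithm

/-- Since `δ` stays below `1/2 - c`, the loss `-log(1 - δ)` is at most a fixed fraction `b / a < 1`
of `log(1/δ)`, the worst case being `δ = 1/2 - c`. -/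
lemma exists_mul_log_le {c : ℝ} (hc : 0 < c) : ∃ κ : ℝ, 0 < κ ∧ ∀ δ : ℝ, 0 < δ → δ < 1 / 2 - c →
    κ * Real.log (1 / δ) ≤ Real.log ((1 - δ) / δ) := by
  by_cases hc2 : 1 / 2 ≤ c
  · exact ⟨1, one_pos, fun δ h h' => by linarith⟩
  push Not at hc2
  set a := Real.log (1 / 2 - c) with ha
  set b := Real.log (1 / 2 + c) with hb
  have ha0 : a < 0 := Real.log_neg (by linarith) (by linarith)
  have hb0 : b < 0 := Real.log_neg (by linarith) (by linarith)
  have hab : a < b := Real.log_lt_log (by linarith) (by linarith)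
  refine ⟨1 - b / a, sub_pos.2 ((div_lt_one_of_neg ha0).2 hab), fun δ hδ0 hδ => ?_⟩
  have h1 : Real.log δ ≤ a := Real.log_le_log hδ0 hδ.le
  have h2 : b ≤ Real.log (1 - δ) := Real.log_le_log (by linarith) (by linarith)
  rw [one_div, Real.log_inv, Real.log_div (by linarith) hδ0.ne']
  have h3 : b / a * Real.log δ ≤ b / a * a :=
    mul_le_mul_of_nonneg_left h1 (div_nonneg_of_nonpos hb0.le ha0.le)
  rw [div_mul_cancel₀ _ ha0.ne] at h3
  linarith

end RoundRobin

theorem theorem8 (ρ : unitInterval) (hρ_pos : 0 < (ρ : ℝ)) (hρ_lt : (ρ : ℝ) < 1 / 2)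
    (c : ℝ) (hc : 0 < c) :
    ∃ C : ℝ, 0 < C ∧
      ∀ n m : ℕ, 2 ≤ n → n ≤ m →
      ∀ δ : ℝ, 0 < δ → δ < 1 / 2 - c →
      ∀ alg : RoundRobin.RandAlgorithm n m, alg.IsCorrect ρ δ →
      ∀ u : Fin n → Fin m → ℝ, RoundRobin.IsUtilityProfile u →
      ∃ adv : RoundRobin.Adversary n m,
        ENNReal.ofReal (C * n * m * Real.log (1 / δ)) ≤ alg.expectedQueries ρ u adv := by
  obtain ⟨κ, hκ, hlog⟩ := RoundRobin.exists_mul_log_le hc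
  have hK := RoundRobin.flipDivergence_pos hρ_pos hρ_lt
  -- The product of `1/4` from the count of sensitive pairs, `κ` from the logarithms, `2c ≤ 1 - 2δ`,
  -- and the inverse of the divergence.
  refine ⟨κ * c / (2 * RoundRobin.flipDivergence ρ), by positivity, ?_⟩
  intro n m hn hnm δ hδ0 hδ alg halg u hu
  obtain ⟨V, hV0, hV⟩ := RoundRobin.exists_forall_lt u
  refine ⟨RoundRobin.constAdversary V, ?_⟩
  by_cases htop : alg.expectedQueries ρ u (RoundRobin.constAdversary V) = ∞
  · rw [htop]
    exact le_top
  refine ENNReal.ofReal_le_of_le_toReal ?_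
  have h1 := halg.card_mul_le_mul_toReal_expectedQueries hρ_pos hρ_lt hδ0 (by linarith) hnm hu
    hV0 hV htop
  have h2 : (n * m : ℝ) ≤ 4 * (RoundRobin.sensitivePairs u).card := by
    exact_mod_cast RoundRobin.mul_le_four_mul_card_sensitivePairs hu hn hnm
  have hl : 0 ≤ Real.log (1 / δ) := Real.log_nonneg (by rw [le_div_iff₀ hδ0]; linarith)
  have h3 : κ * Real.log (1 / δ) * (2 * c) ≤ Real.log ((1 - δ) / δ) * (1 - 2 * δ) :=
    mul_le_mul (hlog δ hδ0 hδ) (by linarith) (by positivity)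
      ((mul_nonneg hκ.le hl).trans (hlog δ hδ0 hδ))
  have h4 : (n * m : ℝ) / 4 * (κ * Real.log (1 / δ) * (2 * c)) ≤
      RoundRobin.flipDivergence ρ *
        (alg.expectedQueries ρ u (RoundRobin.constAdversary V)).toReal :=
    (mul_le_mul (by linarith) h3 (by positivity) (Nat.cast_nonneg _)).trans h1
  rw [← div_le_iff₀' hK] at h4
  refine le_trans (le_of_eq ?_) h4
  field_simp
  ring
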